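/- Let $X$ and $Y$ be (non-empty) Polish spaces with their Borel $\sigma$-algebras, let $c:X\times Y\to[0,\infty)$ be continuous, and let $c_X:X\to\mathbb R$, $c_Y:Y\to\mathbb R$ satisfy $c(x,y)\le c_X(x)+c_Y(y)$ for all $x,y$. Definitions. - A coupling of two finite positive measures $\mu$ on $X$ and $\nu$ on $Y$ is a measure $\gamma$ on $X\times Y$ with marginals $\mu$ and $\nu$; it is optimal if $\int c\,d\gamma$ equals the transport cost $C(\mu,\nu)$, the infimum of $\int c\,d\pi$ over all couplings $\pi$ of $\mu$ and $\nu$. - A set $\Gamma\subseteq X\times Y$ is $c$-cyclically monotone ($c$-CM) if $\sum_{i=1}^N c(x_i,y_i)\le\sum_{i=1}^N c(x_i,y_{\sigma(i)})$ for all $N$, all $(x_1,y_1),\dots,(x_N,y_N)\in\Gamma$ and all permutations $\sigma$. Two couplings $\gamma_1,\gamma_2$ are $c$-CM compatible if $\operatorname{supp}\gamma_1\cup\operatorname{supp}\gamma_2$ is $c$-CM. - For a Markov kernel $K$ from $X$ to $Y$ and a finite (signed or positive) measure $\mu$ on $X$, $(\mu K)(B)=\int_X K(x,B)\,d\mu(x)$;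 for positive $\mu$, $\mu\odot K$ is the measure on $X\times Y$ with $(\mu\odot K)(A\times B)=\int_A K(x,B)\,d\mu(x)$. - For a finite positive measure $\alpha$ on $X$, $\mathscr{ACP}^b_c(\alpha)$ is the set of probability measures $\eta\ll\alpha$ on $X$ with $c_X\in L^1(\eta)$ and bounded density $d\eta/d\alpha$. A Markov kernel $K$ is an optimal transport kernel on $\mathscr{ACP}^b_c(\alpha)$ if for every $\eta\in\mathscr{ACP}^b_c(\alpha)$ with $C(\eta,\eta K)<\infty$ the measure $\eta\odot K$ is an optimal coupling of $\eta$ and $\eta K$. Theorem. Let $a$ and $b$ be finite signed measures on $X$ and $Y$ with Jordan decompositions $a=a^+-a^-$ and $b=b^+-b^-$, and let $\alpha=a^++a^-$, $\beta=b^++b^-$. Assume that $\alpha(X)=\beta(Y)$ (equal mass), $a(X)=b(Y)$ (equal integral), $c_X\in L^1(\alpha)$ and $c_Y\in L^1(\beta)$ (finite moments). Then there is a Markov kernel $K$ from $X$ to $Y$ that is an optimal transport kernel on $\mathscr{ACP}^b_c(\alpha)$ and satisfies $aK=b$ if and only if there are an optimal coupling $\gamma^+$ of $a^+$ and $b^+$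 and an optimal coupling $\gamma^-$ of $a^-$ and $b^-$ that are $c$-CM compatible. -/

import Mathlib

open MeasureTheory ProbabilityTheory
open scoped ENNReal

noncomputable section

/-- `Γ ⊆ X × Y` is `c`-cyclically monotone: for every finite family of points of `Γ` and every
permutation `σ`, `∑ c(xᵢ, yᵢ) ≤ ∑ c(xᵢ, y_{σ(i)})`. -/
def IsCCyclicallyMonotone {X Y : Type*} (c : X × Y → ℝ) (Γ : Set (X × Y)) : Prop :=
  ∀ (N : ℕ) (p : Fin N → X × Y), (∀ i, p i ∈ Γ) → ∀ σ : Equiv.Perm (Fin N),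
    ∑ i, c (p i) ≤ ∑ i, c ((p i).1, (p (σ i)).2)

section Couplings

variable {X Y : Type*} [MeasurableSpace X] [MeasurableSpace Y]

/-- `γ` is a coupling of the (positive, not necessarily probability) measures `μ` and `ν`. -/
def IsCoupling (γ : Measure (X × Y)) (μ : Measure X) (ν : Measure Y) : Prop :=
  γ.map Prod.fst = μ ∧ γ.map Prod.snd = ν

/-- The cost `∫ c dγ` of a coupling, for a non-negative cost function `c`. -/
def couplingCost (c : X × Y → ℝ) (γ : Measure (X × Y)) : ℝ≥0∞ :=
  ∫⁻ p, ENNReal.ofReal (c p) ∂γ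

/-- The optimal transport cost: the infimum of the cost over all couplings. -/
def transportCost (c : X × Y → ℝ) (μ : Measure X) (ν : Measure Y) : ℝ≥0∞ :=
  ⨅ (π : Measure (X × Y)) (_ : IsCoupling π μ ν), couplingCost c π

/-- An optimal coupling is a coupling that attains the optimal transport cost. -/
def IsOptimalCoupling (c : X × Y → ℝ) (γ : Measure (X × Y)) (μ : Measure X) (ν : Measure Y) :
    Prop :=
  IsCoupling γ μ ν ∧ couplingCost c γ = transportCost c μ ν

/-- Probability measures on `X` with finite `cX`-moment that are absolutely continuous with respect
to `α`, with bounded Radon-Nikodym derivative. -/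
def boundedACProb (cX : X → ℝ) (α : Measure X) : Set (Measure X) :=
  {η | IsProbabilityMeasure η ∧ Integrable cX η ∧ η ≪ α ∧
    ∃ M : ℝ, ∀ᵐ x ∂α, η.rnDeriv α x ≤ ENNReal.ofReal M}

/-- The Markov kernel `K` is an optimal transport kernel on the class `𝒜` of measures: for each
`η ∈ 𝒜`, if the transport problem from `η` to `η K` has finite cost, then the product measure
`η ⊙ K` (with `(η ⊙ K)(A × B) = ∫_A K(x, B) dη(x)`) is an optimal coupling of `η` and `η K`. -/
def IsOptimalTransportKernelOn (c : X × Y → ℝ) (𝒜 : Set (Measure X)) (K : Kernel X Y) : Prop :=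
  IsMarkovKernel K ∧ ∀ η ∈ 𝒜, transportCost c η (η.bind K) < ∞ →
    IsOptimalCoupling c (η.compProd K) η (η.bind K)

/-- The image `a K` of a signed measure `a` under a Markov kernel:
`(a K)(B) = ∫ K(x, B) da⁺(x) - ∫ K(x, B) da⁻(x)`. -/
def signedImage (a : SignedMeasure X) (K : Kernel X Y) [IsMarkovKernel K] : SignedMeasure Y :=
  (a.toJordanDecomposition.posPart.bind K).toSignedMeasure -
    (a.toJordanDecomposition.negPart.bind K).toSignedMeasure

/-- `a` and `b` are connected by an optimal transport kernel `K`: `a K = b`, and `K` is an optimal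
transport kernel on the probability measures with finite `cX`-moment that are absolutely continuous,
with bounded density, with respect to the total variation measure of `a`. -/
def ConnectedByOptimalTransportKernel (c : X × Y → ℝ) (cX : X → ℝ) (a : SignedMeasure X)
    (b : SignedMeasure Y) : Prop :=
  ∃ (K : Kernel X Y) (_ : IsMarkovKernel K), signedImage a K = b ∧
    IsOptimalTransportKernelOn c (boundedACProb cX a.totalVariation) K

/-- Two couplings are `c`-CM compatible if the union of their (topological) supports is
`c`-cyclically monotone. -/
def CCMCompatible [TopologicalSpace X] [TopologicalSpace Y] (c : X × Y → ℝ)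
    (γ₁ γ₂ : Measure (X × Y)) : Prop :=
  IsCCyclicallyMonotone c (γ₁.support ∪ γ₂.support)

end Couplings

end

/-!
The link between the two sides is that, for couplings of finite cost and a continuous cost function,
optimality and `c`-cyclical monotonicity of the support are equivalent. The latter is a property of
a set, so it makes every measure of finite cost that is concentrated on that set optimal at once.

If the support of an optimal coupling violated the condition at points `(xᵢ, yᵢ)`, a small amount of
mass near each `(xᵢ, yᵢ)` could be rerouted to near `(xᵢ, y_{σ(i)})`, which lowers the cost
(`IsOptimalCoupling.isCCyclicallyMonotone_support`). Conversely, let `π` be concentrated on a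
`c`-cyclically monotone set `Γ` and let `π'` be another coupling of the same measures. The
Rockafellar potential `φ` of `Γ` satisfies `φ(x) - φ(x') ≤ c(x, y) - c(x', y)` whenever
`(x', y) ∈ Γ` (`chainPotential_le_add`). Gluing `π'` and `π` along `Y` gives a law of triples
`(x, y, x')` with `(x, y) ∼ π'` and `(x', y) ∼ π`. As `x` and `x'` have the same law, the truncated
differences of `φ` have mean zero, and `∫ c dπ ≤ ∫ c dπ'` follows in the limit without integrability
of `φ` (`integral_nonneg_of_sub_le_of_map_eq`, `IsCCyclicallyMonotone.isOptimalCoupling`). This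
avoids a second, possibly non-measurable, potential on `Y`.

For the theorem, let `α = a⁺ + a⁻` and suppose that `K` is given. The minimality of the Jordan
decomposition and the equality of the masses yield `a⁺ K = b⁺` and `a⁻ K = b⁻`. The normalization of
`α` is an admissible source, so that `α ⊙ K = a⁺ ⊙ K + a⁻ ⊙ K` has `c`-cyclically monotone support,
which is the union of the supports of the two summands; both summands are therefore optimal.
Conversely, given `γ⁺` and `γ⁻`, the mutual singularity of `a⁺` and `a⁻` allows both to be
disintegrated by one kernel `K`. Then `η ⊙ K ≪ α ⊙ K = γ⁺ + γ⁻` for each admissible `η`, and the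
bound on its density gives `η K` a finite `cY`-moment, so that `η ⊙ K` has finite cost and is
optimal.
-/

/-! ### The Rockafellar potential -/

/-- The value at `x` of the chain `p 0, …, p n`, that is
`c(x, yₙ) - c(xₙ, yₙ) + ∑ i < n, (c(xᵢ₊₁, yᵢ) - c(xᵢ, yᵢ))` where `p i = (xᵢ, yᵢ)`. -/
def chainValue {X Y : Type*} (c : X × Y → ℝ) (n : ℕ) (p : ℕ → X × Y) (x : X) : ℝ :=
  c (x, (p n).2) - c (p n) + ∑ i ∈ Finset.range n, (c ((p (i + 1)).1, (p i).2) - c (p i))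

/-- The Rockafellar potential of `Γ` with base point `p₀`: the infimum of `chainValue` over all
chains in `Γ` that start at `p₀`. It takes the value `⊥` where the infimum is unbounded below. -/
noncomputable def chainPotential {X Y : Type*} (c : X × Y → ℝ) (Γ : Set (X × Y))
    (p₀ : X × Y) (x : X) : EReal :=
  ⨅ q : ℕ × {p : ℕ → X × Y // p 0 = p₀ ∧ ∀ i, p i ∈ Γ}, (chainValue c q.1 q.2 x : EReal)

section Potential

variable {X Y : Type*} {c : X × Y → ℝ} {Γ : Set (X × Y)} {p₀ : X × Y}

/-- A chain that returns to its base point is the sum in the definition of `c`-cyclical monotonicity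
for a cyclic permutation. -/
lemma IsCCyclicallyMonotone.chainValue_nonneg (hΓ : IsCCyclicallyMonotone c Γ)
    (n : ℕ) {p : ℕ → X × Y} (hp : ∀ i, p i ∈ Γ) : 0 ≤ chainValue c n p (p 0).1 := by
  have h := hΓ (n + 1) (fun i => p i) (fun i => hp i) (finRotate (n + 1)).symm
  rw [← Equiv.sum_comp (finRotate (n + 1)) (fun i : Fin (n + 1) =>
    c ((p i).1, (p ((finRotate (n + 1)).symm i : Fin (n + 1))).2))] at h
  simp only [Equiv.symm_apply_apply] at h
  rw [Fin.sum_univ_castSucc, Fin.sum_univ_castSucc] at h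
  simp only [finRotate_last, coe_finRotate, Fin.val_castSucc, Fin.val_last, Fin.val_zero,
    (Fin.castSucc_lt_last _).ne, if_false] at h
  rw [Fin.sum_univ_eq_sum_range (fun i => c (p i)) n,
    Fin.sum_univ_eq_sum_range (fun i => c ((p (i + 1)).1, (p i).2)) n] at h
  rw [chainValue, Finset.sum_sub_distrib]
  linarith

lemma chainPotential_le (n : ℕ) {p : ℕ → X × Y} (hp : ∀ i, p i ∈ Γ) (x : X) :
    chainPotential c Γ (p 0) x ≤ chainValue c n p x :=
  iInf_le (fun q : ℕ × {r : ℕ → X × Y // r 0 = p 0 ∧ ∀ i, r i ∈ Γ} =>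
    (chainValue c q.1 q.2 x : EReal)) (n, ⟨p, rfl, hp⟩)

lemma chainPotential_ne_top (hp₀ : p₀ ∈ Γ) (x : X) : chainPotential c Γ p₀ x ≠ ⊤ :=
  ((chainPotential_le 0 (p := fun _ => p₀) (fun _ => hp₀) x).trans_lt (EReal.coe_lt_top _)).ne

/-- Appending a point of `Γ` to a chain yields the `c`-concavity inequality for the potential. -/
lemma chainPotential_le_add {q : X × Y} (hq : q ∈ Γ) (x : X) :
    chainPotential c Γ p₀ x ≤
      chainPotential c Γ p₀ q.1 + ((c (x, q.2) - c q : ℝ) : EReal) := by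
  rw [← EReal.sub_le_iff_le_add (.inl (EReal.coe_ne_bot _)) (.inl (EReal.coe_ne_top _))]
  refine le_iInf ?_
  rintro ⟨n, p, rfl, hp⟩
  rw [EReal.sub_le_iff_le_add (.inl (EReal.coe_ne_bot _)) (.inl (EReal.coe_ne_top _))]
  -- the chain `p 0, …, p n, q`
  set p' : ℕ → X × Y := Function.update p (n + 1) q with hp'
  have h0 : p' 0 = p 0 := Function.update_of_ne (by omega) _ _
  have hle : ∀ i ≤ n, p' i = p i := fun i hi => Function.update_of_ne (by omega) _ _
  have hlast : p' (n + 1) = q := Function.update_self ..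
  have hmem : ∀ i, p' i ∈ Γ := by
    intro i
    by_cases hi : i = n + 1
    · rw [hi, hlast]; exact hq
    · rw [hp', Function.update_of_ne hi]; exact hp i
  have h := chainPotential_le (c := c) (n + 1) hmem x
  rw [h0] at h
  refine h.trans (le_of_eq ?_)
  rw [← EReal.coe_add]
  congr 1
  have hsum : ∑ i ∈ Finset.range n, (c ((p' (i + 1)).1, (p' i).2) - c (p' i)) =
      ∑ i ∈ Finset.range n, (c ((p (i + 1)).1, (p i).2) - c (p i)) := by
    refine Finset.sum_congr rfl fun i hi => ?_
    have := Finset.mem_range.1 hi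
    rw [hle i (by omega), hle (i + 1) (by omega)]
  simp only [chainValue]
  rw [Finset.sum_range_succ, hsum, hlast, hle n le_rfl]
  ring

lemma chainPotential_ne_bot (hΓ : IsCCyclicallyMonotone c Γ) {q : X × Y}
    (hq : q ∈ Γ) : chainPotential c Γ p₀ q.1 ≠ ⊥ := by
  intro hbot
  have h := chainPotential_le_add (c := c) (p₀ := p₀) hq p₀.1
  rw [hbot, EReal.bot_add] at h
  have h0 : (0 : EReal) ≤ chainPotential c Γ p₀ p₀.1 := by
    refine le_iInf ?_
    rintro ⟨n, p, rfl, hp⟩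
    exact_mod_cast hΓ.chainValue_nonneg n hp
  exact absurd (h0.trans h) (by simp)

variable [TopologicalSpace X] [TopologicalSpace Y] [MeasurableSpace X] [OpensMeasurableSpace X]

lemma measurable_chainPotential (hc : Continuous c) : Measurable (chainPotential c Γ p₀) := by
  refine UpperSemicontinuous.measurable (upperSemicontinuous_iInf fun q => ?_)
  refine Continuous.upperSemicontinuous ?_
  refine continuous_coe_real_ereal.comp ?_
  unfold chainValue
  fun_prop

end Potential

/-! ### Differences of random variables with the same law -/

section Truncation

/-- Two real random variables `U`, `V` with the same law satisfy `0 ≤ E[F]` for every integrable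
`F ≥ U - V`, even when `U` and `V` are not integrable. -/
lemma integral_nonneg_of_sub_le_of_map_eq {Ω : Type*} [MeasurableSpace Ω] {θ : Measure Ω}
    [IsFiniteMeasure θ] {U V F : Ω → ℝ} (hU : Measurable U) (hV : Measurable V)
    (hUV : θ.map U = θ.map V) (hF : Integrable F θ) (hle : ∀ᵐ ω ∂θ, U ω - V ω ≤ F ω) :
    0 ≤ ∫ ω, F ω ∂θ := by
  let T : ℕ → ℝ → ℝ := fun n t => max (-(n : ℝ)) (min (n : ℝ) t)
  have hT : ∀ n, Measurable (T n) := fun n => by fun_prop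
  have hTb : ∀ n t, ‖T n t‖ ≤ n := by
    intro n t
    rw [Real.norm_eq_abs, abs_le]
    have : (0 : ℝ) ≤ n := n.cast_nonneg
    exact ⟨le_max_left _ _, max_le (by linarith) (min_le_left _ _)⟩
  have hTl : ∀ t, ∀ᶠ n : ℕ in Filter.atTop, T n t = t := by
    intro t
    obtain ⟨m, hm⟩ := exists_nat_ge |t|
    filter_upwards [Filter.eventually_ge_atTop m] with n hn
    have h1 : |t| ≤ n := hm.trans (by exact_mod_cast hn)
    obtain ⟨h2, h3⟩ := abs_le.1 h1
    simp only [T]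
    rw [min_eq_right h3, max_eq_right h2]
  -- truncation is monotone and `1`-Lipschitz
  have hTd : ∀ n s t, T n s - T n t ≤ max (s - t) 0 := by
    intro n s t
    simp only [T]
    rcases le_total s t with h | h
    · have : max (-(n : ℝ)) (min n s) ≤ max (-(n : ℝ)) (min n t) := by gcongr
      exact (sub_nonpos.2 this).trans (le_max_right _ _)
    · refine le_trans ?_ (le_max_left _ _)
      have h1 : min (n : ℝ) s ≤ min (n : ℝ) t + (s - t) := by
        rcases le_total (n : ℝ) t with h2 | h2
        · rw [min_eq_left h2]; exact (min_le_left _ _).trans (by linarith)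
        · rw [min_eq_right h2]; exact (min_le_right _ _).trans (by linarith)
      rw [sub_le_iff_le_add]
      refine max_le ?_ ?_
      · linarith [le_max_left (-(n : ℝ)) (min (n : ℝ) t)]
      · linarith [le_max_right (-(n : ℝ)) (min (n : ℝ) t)]
  have hIU : ∀ n, Integrable (fun ω => T n (U ω)) θ := fun n =>
    Integrable.of_bound ((hT n).comp hU).aestronglyMeasurable n (.of_forall fun _ => hTb _ _)
  have hIV : ∀ n, Integrable (fun ω => T n (V ω)) θ := fun n =>
    Integrable.of_bound ((hT n).comp hV).aestronglyMeasurable n (.of_forall fun _ => hTb _ _)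
  -- the truncations are integrable, with the same integral because the laws agree
  have hzero : ∀ n, ∫ ω, (T n (U ω) - T n (V ω)) ∂θ = 0 := by
    intro n
    rw [integral_sub (hIU n) (hIV n),
      ← integral_map (f := T n) hU.aemeasurable (hT n).aestronglyMeasurable,
      ← integral_map (f := T n) hV.aemeasurable (hT n).aestronglyMeasurable, hUV, sub_self]
  have hlim : Filter.Tendsto (fun n : ℕ => ∫ ω, max (T n (U ω) - T n (V ω)) (F ω) ∂θ)
      Filter.atTop (nhds (∫ ω, F ω ∂θ)) := by
    refine tendsto_integral_of_dominated_convergence (fun ω => |F ω|)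
      (fun n => (((hIU n).sub (hIV n)).sup hF).aestronglyMeasurable) hF.abs ?_ ?_
    · intro n
      filter_upwards [hle] with ω hω
      rw [Real.norm_eq_abs, abs_le]
      refine ⟨(neg_abs_le _).trans (le_max_right _ _), max_le ?_ (le_abs_self _)⟩
      exact (hTd n _ _).trans (max_le (hω.trans (le_abs_self _)) (abs_nonneg _))
    · filter_upwards [hle] with ω hω
      refine tendsto_const_nhds.congr' ?_
      filter_upwards [hTl (U ω), hTl (V ω)] with n h1 h2
      rw [h1, h2, max_eq_right hω]
  refine ge_of_tendsto' hlim fun n => ?_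
  rw [← hzero n]
  exact integral_mono ((hIU n).sub (hIV n)) (((hIU n).sub (hIV n)).sup hF)
    fun ω => le_max_left _ _

end Truncation

/-! ### Optimality of cyclically monotone couplings -/

section Sufficiency

variable {X Y : Type*} [MeasurableSpace X] [MeasurableSpace Y]

lemma IsCoupling.isFiniteMeasure {π : Measure (X × Y)} {μ : Measure X} {ν : Measure Y}
    [IsFiniteMeasure μ] (h : IsCoupling π μ ν) : IsFiniteMeasure π := by
  refine ⟨?_⟩
  have := measure_lt_top μ Set.univ
  rwa [← h.1, Measure.map_apply measurable_fst .univ, Set.preimage_univ] at this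

/-- Two finite measures on `X × Y` with the same second marginal can be glued along `Y`: there is a
law of `((x, y), x')` such that `(x, y)` has law `π'` and `(x', y)` has law `π`. -/
lemma exists_gluing [StandardBorelSpace X] [Nonempty X]
    {π π' : Measure (X × Y)} [IsFiniteMeasure π] [IsFiniteMeasure π']
    (h : π.snd = π'.snd) :
    ∃ θ : Measure ((X × Y) × X), θ.map Prod.fst = π' ∧
      θ.map (fun q => (q.2, q.1.2)) = π := by
  set κ := (π.map Prod.swap).condKernel
  refine ⟨π' ⊗ₘ κ.comap Prod.snd measurable_snd, Measure.fst_compProd _ _, ?_⟩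
  ext s hs
  rw [Measure.map_apply (by fun_prop) hs, Measure.compProd_apply (by measurability)]
  have key : π.map Prod.swap = π'.snd ⊗ₘ κ := by
    rw [← h, ← Measure.fst_map_swap]
    exact (Measure.disintegrate _ _).symm
  have h1 : π s = (π.map Prod.swap) (Prod.swap ⁻¹' s) := by
    rw [Measure.map_apply measurable_swap (measurable_swap hs), ← Set.preimage_comp]
    simp
  rw [h1, key, Measure.compProd_apply (measurable_swap hs), Measure.snd,
    lintegral_map (Kernel.measurable_kernel_prodMk_left (measurable_swap hs)) measurable_snd]
  rfl

variable [TopologicalSpace X] [PolishSpace X] [BorelSpace X] [Nonempty X]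
  [TopologicalSpace Y] [PolishSpace Y] [BorelSpace Y]

/-- A coupling with finite cost that is concentrated on a `c`-cyclically monotone set is optimal. -/
theorem IsCCyclicallyMonotone.isOptimalCoupling {c : X × Y → ℝ} (hc : Continuous c)
    (hc_nonneg : ∀ p, 0 ≤ c p) {Γ : Set (X × Y)} (hΓ : IsCCyclicallyMonotone c Γ)
    {π : Measure (X × Y)} {μ : Measure X} {ν : Measure Y} [IsFiniteMeasure μ]
    (hπ : IsCoupling π μ ν) (hπΓ : ∀ᵐ p ∂π, p ∈ Γ) (hfin : couplingCost c π ≠ ∞) :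
    IsOptimalCoupling c π μ ν := by
  refine ⟨hπ, le_antisymm (le_iInf₂ fun π' hπ' => ?_) (iInf₂_le π hπ)⟩
  rcases eq_or_ne π 0 with rfl | hne
  · simp [couplingCost]
  rcases eq_or_ne (couplingCost c π') ∞ with htop | hfin'
  · rw [htop]; exact le_top
  have := hπ.isFiniteMeasure
  have := hπ'.isFiniteMeasure
  obtain ⟨θ, hθ', hθ⟩ := exists_gluing (π := π) (π' := π')
    (show π.map Prod.snd = π'.map Prod.snd by rw [hπ.2, hπ'.2])
  have hfinθ : IsFiniteMeasure θ := by
    refine ⟨?_⟩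
    have := measure_lt_top π' Set.univ
    rwa [← hθ', Measure.map_apply measurable_fst .univ, Set.preimage_univ] at this
  have hcm := hc.measurable
  have hg : Measurable (fun q : (X × Y) × X => (q.2, q.1.2)) := by fun_prop
  have : (ae π).NeBot := ae_neBot.2 hne
  obtain ⟨p₀, hp₀⟩ := hπΓ.exists
  set φ := chainPotential c Γ p₀
  have hφ : Measurable φ := measurable_chainPotential hc
  have hφr : Measurable fun x => (φ x).toReal := hφ.ereal_toReal
  have hint : Integrable c π :=
    ⟨hcm.aestronglyMeasurable, by
      rw [hasFiniteIntegral_iff_ofReal (.of_forall hc_nonneg)]; exact lt_top_iff_ne_top.2 hfin⟩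
  have hint' : Integrable c π' :=
    ⟨hcm.aestronglyMeasurable, by
      rw [hasFiniteIntegral_iff_ofReal (.of_forall hc_nonneg)]; exact lt_top_iff_ne_top.2 hfin'⟩
  have hbotμ : ∀ᵐ x ∂μ, φ x ≠ ⊥ := by
    rw [← hπ.1, ae_map_iff (p := fun x => φ x ≠ ⊥) measurable_fst.aemeasurable
      (hφ (measurableSet_singleton _).compl)]
    filter_upwards [hπΓ] with p hp using chainPotential_ne_bot hΓ hp
  have hbotθ : ∀ᵐ q ∂θ, φ q.1.1 ≠ ⊥ := by
    have h1 : ∀ᵐ p ∂π', φ p.1 ≠ ⊥ :=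
      ae_of_ae_map measurable_fst.aemeasurable (by rw [hπ'.1]; exact hbotμ)
    rw [← hθ'] at h1
    exact ae_of_ae_map measurable_fst.aemeasurable h1
  have hΓθ : ∀ᵐ q ∂θ, (q.2, q.1.2) ∈ Γ := by
    rw [← hθ] at hπΓ
    exact ae_of_ae_map hg.aemeasurable hπΓ
  have hI1 : Integrable (fun q : (X × Y) × X => c q.1) θ := by
    rw [← hθ'] at hint'
    exact hint'.comp_measurable measurable_fst
  have hI2 : Integrable (fun q : (X × Y) × X => c (q.2, q.1.2)) θ := by
    rw [← hθ] at hint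
    exact hint.comp_measurable hg
  have hkey := integral_nonneg_of_sub_le_of_map_eq (θ := θ)
    (U := fun q => (φ q.1.1).toReal) (V := fun q => (φ q.2).toReal)
    (F := fun q => c q.1 - c (q.2, q.1.2))
    (hφr.comp (by fun_prop)) (hφr.comp (by fun_prop)) ?_ (hI1.sub hI2) ?_
  · rw [integral_sub hI1 hI2, sub_nonneg] at hkey
    have e1 : ∫ q, c q.1 ∂θ = ∫ p, c p ∂π' := by
      rw [← hθ', integral_map measurable_fst.aemeasurable hcm.aestronglyMeasurable]
    have e2 : ∫ q, c (q.2, q.1.2) ∂θ = ∫ p, c p ∂π := by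
      rw [← hθ, integral_map hg.aemeasurable hcm.aestronglyMeasurable]
    rw [e1, e2] at hkey
    unfold couplingCost
    rw [← ofReal_integral_eq_lintegral_ofReal hint (.of_forall hc_nonneg),
      ← ofReal_integral_eq_lintegral_ofReal hint' (.of_forall hc_nonneg)]
    exact ENNReal.ofReal_le_ofReal hkey
  -- both `X`-coordinates have law `μ` under `θ`
  · have l1 : θ.map (fun q => q.1.1) = μ := by
      rw [← hπ'.1, ← hθ', Measure.map_map measurable_fst measurable_fst]; rfl
    have l2 : θ.map (fun q => q.2) = μ := by
      rw [← hπ.1, ← hθ, Measure.map_map measurable_fst hg]; rfl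
    have m1 := Measure.map_map (μ := θ) hφr (f := fun q : (X × Y) × X => q.1.1) (by fun_prop)
    have m2 := Measure.map_map (μ := θ) hφr (f := fun q : (X × Y) × X => q.2) (by fun_prop)
    rw [l1] at m1
    rw [l2] at m2
    exact m1.symm.trans m2
  · filter_upwards [hbotθ, hΓθ] with q hq1 hq2
    have h := chainPotential_le_add (c := c) (p₀ := p₀) hq2 q.1.1
    have h2 : φ q.2 ≠ ⊥ := chainPotential_ne_bot hΓ hq2
    change φ q.1.1 ≤ φ q.2 + _ at h
    rw [← EReal.coe_toReal (show φ q.1.1 ≠ ⊤ from chainPotential_ne_top hp₀ _) hq1,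
      ← EReal.coe_toReal (show φ q.2 ≠ ⊤ from chainPotential_ne_top hp₀ _) h2, ← EReal.coe_add,
      EReal.coe_le_coe_iff] at h
    simp only at h ⊢
    linarith

end Sufficiency

/-! ### Cyclical monotonicity of optimal couplings -/

section Necessity

variable {X Y : Type*} [TopologicalSpace X] [TopologicalSpace Y]

/-- Around finitely many points `(xᵢ, yᵢ)` there are boxes `Uᵢ × Vᵢ` such that `c` falls by less
than `ε` below `c(xᵢ, yᵢ)` on `Uᵢ × Vᵢ` and exceeds `c(xᵢ, y_{σ(i)})` by less than `ε` on
`Uᵢ × V_{σ(i)}`. -/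
lemma exists_open_boxes {c : X × Y → ℝ} (hc : Continuous c) {N : ℕ} (p : Fin N → X × Y)
    (σ : Equiv.Perm (Fin N)) {ε : ℝ} (hε : 0 < ε) :
    ∃ (U : Fin N → Set X) (V : Fin N → Set Y),
      (∀ i, IsOpen (U i) ∧ (p i).1 ∈ U i) ∧ (∀ i, IsOpen (V i) ∧ (p i).2 ∈ V i) ∧
      (∀ i, ∀ x ∈ U i, ∀ y ∈ V i, c (p i) - ε < c (x, y)) ∧
      (∀ i, ∀ x ∈ U i, ∀ y ∈ V (σ i), c (x, y) < c ((p i).1, (p (σ i)).2) + ε) := by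
  have h1 : ∀ i, ∃ (A : Set X) (B : Set Y), IsOpen A ∧ IsOpen B ∧ (p i).1 ∈ A ∧ (p i).2 ∈ B ∧
      A ×ˢ B ⊆ {q | c (p i) - ε < c q} := fun i =>
    isOpen_prod_iff.1 (isOpen_lt continuous_const hc) (p i).1 (p i).2
      (by change c (p i) - ε < c (p i); linarith)
  have h2 : ∀ i, ∃ (A : Set X) (B : Set Y), IsOpen A ∧ IsOpen B ∧ (p i).1 ∈ A ∧
      (p (σ i)).2 ∈ B ∧ A ×ˢ B ⊆ {q | c q < c ((p i).1, (p (σ i)).2) + ε} := fun i =>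
    isOpen_prod_iff.1 (isOpen_lt hc continuous_const) (p i).1 (p (σ i)).2
      (by
        change c ((p i).1, (p (σ i)).2) < c ((p i).1, (p (σ i)).2) + ε
        linarith)
  choose A B hA hB hxA hyB hAB using h1
  choose C D hC hD hxC hyD hCD using h2
  refine ⟨fun i => A i ∩ C i, fun i => B i ∩ D (σ.symm i),
    fun i => ⟨(hA i).inter (hC i), hxA i, hxC i⟩,
    fun i => ⟨(hB i).inter (hD _), hyB i, ?_⟩, ?_, ?_⟩
  · simpa using hyD (σ.symm i)
  · intro i x hx y hy
    exact hAB i ⟨hx.1, hy.1⟩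
  · intro i x hx y hy
    refine hCD i ⟨hx.2, ?_⟩
    simpa using hy.2

variable [MeasurableSpace X] [MeasurableSpace Y] [OpensMeasurableSpace X] [OpensMeasurableSpace Y]

/-- The support of an optimal coupling with finite cost is `c`-cyclically monotone: otherwise a
small amount of mass near the points violating the condition could be rerouted along the
permutation, which would lower the cost. -/
theorem IsOptimalCoupling.isCCyclicallyMonotone_support {c : X × Y → ℝ} (hc : Continuous c)
    (hc_nonneg : ∀ p, 0 ≤ c p) {γ : Measure (X × Y)} [IsFiniteMeasure γ] {μ : Measure X}
    {ν : Measure Y} (h : IsOptimalCoupling c γ μ ν) (hfin : couplingCost c γ ≠ ∞) :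
    IsCCyclicallyMonotone c γ.support := by
  intro N p hp σ
  by_contra! hlt
  have hN : 0 < (N : ℝ) := by
    rcases N.eq_zero_or_pos with rfl | hN
    · simp at hlt
    · exact_mod_cast hN
  set S := ∑ i, c (p i) with hS
  set S' := ∑ i, c ((p i).1, (p (σ i)).2) with hS'
  have hS'0 : 0 ≤ S' := Finset.sum_nonneg fun i _ => hc_nonneg _
  -- with this `ε`, the `2 N` errors of size `ε` add up to less than `S - S'`
  set ε : ℝ := (S - S') / (3 * N) with hε
  have hε0 : 0 < ε := div_pos (by linarith) (by positivity)
  have hNε : 3 * (N * ε) = S - S' := by rw [hε]; field_simp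
  obtain ⟨U, V, hU, hV, hlow, hup⟩ := exists_open_boxes hc p σ hε0
  have hUm : ∀ i, MeasurableSet (U i) := fun i => (hU i).1.measurableSet
  have hVm : ∀ i, MeasurableSet (V i) := fun i => (hV i).1.measurableSet
  have hpos : ∀ i, γ (U i ×ˢ V i) ≠ 0 := fun i =>
    ((Measure.mem_support_iff_forall _).1 (hp i) _
      (((hU i).1.prod (hV i).1).mem_nhds ⟨(hU i).2, (hV i).2⟩)).ne'
  set ρ : Fin N → Measure (X × Y) := fun i => cond γ (U i ×ˢ V i) with hρ
  have hρprob : ∀ i, IsProbabilityMeasure (ρ i) := fun i => cond_isProbabilityMeasure (hpos i)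
  have hρmem : ∀ i, ∀ᵐ q ∂ρ i, q ∈ U i ×ˢ V i := fun i =>
    ae_cond_mem ((hUm i).prod (hVm i))
  have hρU : ∀ i, ∀ᵐ x ∂(ρ i).fst, x ∈ U i := fun i => by
    rw [Measure.fst, ae_map_iff (p := fun x => x ∈ U i) measurable_fst.aemeasurable (hUm i)]
    filter_upwards [hρmem i] with q hq using hq.1
  have hρV : ∀ i, ∀ᵐ y ∂(ρ i).snd, y ∈ V i := fun i => by
    rw [Measure.snd, ae_map_iff (p := fun y => y ∈ V i) measurable_snd.aemeasurable (hVm i)]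
    filter_upwards [hρmem i] with q hq using hq.2
  obtain ⟨t, ht0, htop, ht⟩ : ∃ t : ℝ≥0∞, t ≠ 0 ∧ t ≠ ∞ ∧ ∀ i, t ≤ γ (U i ×ˢ V i) / N := by
    refine ⟨(⨅ i, γ (U i ×ˢ V i)) / N ⊓ 1, ?_, ?_, fun i => ?_⟩
    · rw [← bot_eq_zero, ← bot_lt_iff_ne_bot, lt_inf_iff]
      refine ⟨ENNReal.div_pos ?_ (ENNReal.natCast_ne_top _), one_pos⟩
      have : Nonempty (Fin N) := ⟨⟨0, by exact_mod_cast hN⟩⟩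
      obtain ⟨i, hi⟩ := exists_eq_ciInf_of_finite (f := fun i => γ (U i ×ˢ V i))
      rw [← hi]
      exact hpos i
    · exact (inf_le_right.trans_lt ENNReal.one_lt_top).ne
    · exact inf_le_left.trans (ENNReal.div_le_div_right (iInf_le _ i) _)
  have hsub : t • ∑ i, ρ i ≤ γ := by
    have h1 : ∀ i, t • ρ i ≤ (N : ℝ≥0∞)⁻¹ • γ := by
      intro i
      rw [hρ]
      simp only [ProbabilityTheory.cond]
      rw [smul_smul]
      refine Measure.le_iff.2 fun s _ => ?_
      simp only [Measure.smul_apply, smul_eq_mul]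
      gcongr
      · calc t * (γ (U i ×ˢ V i))⁻¹ ≤ γ (U i ×ˢ V i) / N * (γ (U i ×ˢ V i))⁻¹ := by
              gcongr; exact ht i
          _ = (N : ℝ≥0∞)⁻¹ * (γ (U i ×ˢ V i) * (γ (U i ×ˢ V i))⁻¹) := by
              rw [div_eq_mul_inv]; ring
          _ = (N : ℝ≥0∞)⁻¹ := by
              rw [ENNReal.mul_inv_cancel (hpos i) (measure_ne_top _ _), mul_one]
      · exact Measure.restrict_le_self
    rw [Finset.smul_sum]
    refine (Finset.sum_le_sum fun i _ => h1 i).trans (le_of_eq ?_)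
    rw [Finset.sum_const, Finset.card_univ, Fintype.card_fin, ← Nat.cast_smul_eq_nsmul ℝ≥0∞,
      smul_smul, ENNReal.mul_inv_cancel (by exact_mod_cast hN.ne') (ENNReal.natCast_ne_top _),
      one_smul]
  have : IsFiniteMeasure (t • ∑ i, ρ i) := isFiniteMeasure_of_le γ hsub
  set κ := γ - t • ∑ i, ρ i
  have hγ : κ + t • ∑ i, ρ i = γ := Measure.sub_add_cancel_of_le hsub
  set τ : Fin N → Measure (X × Y) := fun i => (ρ i).fst.prod (ρ (σ i)).snd with hτ
  have hcoup : IsCoupling (κ + t • ∑ i, τ i) μ ν := by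
    have e1 : (∑ i, τ i).map Prod.fst = (∑ i, ρ i).map Prod.fst := by
      rw [← Measure.mapₗ_apply_of_measurable measurable_fst,
        ← Measure.mapₗ_apply_of_measurable measurable_fst, map_sum, map_sum]
      refine Finset.sum_congr rfl fun i _ => ?_
      rw [Measure.mapₗ_apply_of_measurable measurable_fst,
        Measure.mapₗ_apply_of_measurable measurable_fst]
      exact Measure.fst_prod
    have e2 : (∑ i, τ i).map Prod.snd = (∑ i, ρ i).map Prod.snd := by
      rw [← Measure.mapₗ_apply_of_measurable measurable_snd,
        ← Measure.mapₗ_apply_of_measurable measurable_snd, map_sum, map_sum,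
        ← Equiv.sum_comp σ fun i => Measure.mapₗ Prod.snd (ρ i)]
      refine Finset.sum_congr rfl fun i _ => ?_
      rw [Measure.mapₗ_apply_of_measurable measurable_snd,
        Measure.mapₗ_apply_of_measurable measurable_snd]
      exact Measure.snd_prod
    constructor
    · rw [Measure.map_add _ _ measurable_fst, Measure.map_smul, e1, ← Measure.map_smul,
        ← Measure.map_add _ _ measurable_fst, hγ, h.1.1]
    · rw [Measure.map_add _ _ measurable_snd, Measure.map_smul, e2, ← Measure.map_smul,
        ← Measure.map_add _ _ measurable_snd, hγ, h.1.2]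
  have hcost : ∀ m : Fin N → Measure (X × Y), couplingCost c (κ + t • ∑ i, m i) =
      couplingCost c κ + t * ∑ i, couplingCost c (m i) := fun m => by
    simp only [couplingCost]
    rw [lintegral_add_measure, lintegral_smul_measure, lintegral_finsetSum_measure, smul_eq_mul]
  have hκfin : couplingCost c κ ≠ ∞ := by
    rw [← hγ, hcost] at hfin
    exact (ENNReal.add_ne_top.1 hfin).1
  have hρcost : ENNReal.ofReal (S - N * ε) ≤ ∑ i, couplingCost c (ρ i) := by
    have : S - N * ε = ∑ i, (c (p i) - ε) := by
      rw [Finset.sum_sub_distrib]; simp [hS]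
    rw [this]
    refine (Finset.le_sum_of_subadditive ENNReal.ofReal ENNReal.ofReal_zero.le
      (fun _ _ => ENNReal.ofReal_add_le) _ _).trans (Finset.sum_le_sum fun i _ => ?_)
    calc ENNReal.ofReal (c (p i) - ε) = ∫⁻ _, ENNReal.ofReal (c (p i) - ε) ∂ρ i := by simp
      _ ≤ _ := by
        refine lintegral_mono_ae ?_
        filter_upwards [hρmem i] with q hq
        exact ENNReal.ofReal_le_ofReal (hlow i q.1 hq.1 q.2 hq.2).le
  have hτcost : ∑ i, couplingCost c (τ i) ≤ ENNReal.ofReal (S' + N * ε) := by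
    have : S' + N * ε = ∑ i, (c ((p i).1, (p (σ i)).2) + ε) := by
      rw [Finset.sum_add_distrib]; simp [hS']
    rw [this, ENNReal.ofReal_sum_of_nonneg fun i _ => add_nonneg (hc_nonneg _) hε0.le]
    refine Finset.sum_le_sum fun i _ => ?_
    have hτprob : IsProbabilityMeasure (τ i) := by simp only [hτ]; infer_instance
    calc _ ≤ ∫⁻ _, ENNReal.ofReal (c ((p i).1, (p (σ i)).2) + ε) ∂τ i := by
          refine lintegral_mono_ae ?_
          filter_upwards [Measure.quasiMeasurePreserving_fst.ae (hρU i),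
            Measure.quasiMeasurePreserving_snd.ae (hρV (σ i))] with q hq1 hq2
          exact ENNReal.ofReal_le_ofReal (hup i q.1 hq1 q.2 hq2).le
      _ = _ := by simp
  have hstrict : couplingCost c (κ + t • ∑ i, τ i) < couplingCost c γ := by
    conv_rhs => rw [← hγ]
    rw [hcost, hcost]
    refine ENNReal.add_lt_add_left hκfin ?_
    refine (ENNReal.mul_lt_mul_iff_right ht0 htop).2 ?_
    refine hτcost.trans_lt (lt_of_lt_of_le ?_ hρcost)
    refine (ENNReal.ofReal_lt_ofReal_iff (by nlinarith [mul_pos hN hε0])).2 ?_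
    nlinarith [mul_pos hN hε0]
  exact hstrict.not_ge (h.2.le.trans (iInf₂_le (κ + t • ∑ i, τ i) hcoup))

end Necessity

/-! ### Couplings of finite cost -/

section FiniteCost

variable {X Y : Type*} [MeasurableSpace X] [MeasurableSpace Y]

lemma IsCoupling.couplingCost_ne_top {c : X × Y → ℝ} {cX : X → ℝ} {cY : Y → ℝ}
    (hc_le : ∀ x y, c (x, y) ≤ cX x + cY y) {π : Measure (X × Y)} {μ : Measure X} {ν : Measure Y}
    (h : IsCoupling π μ ν) (hX : Integrable cX μ) (hY : Integrable cY ν) :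
    couplingCost c π ≠ ∞ := by
  obtain ⟨rfl, rfl⟩ := h
  have hI : Integrable (fun p : X × Y => cX p.1 + cY p.2) π :=
    (hX.comp_measurable measurable_fst).add (hY.comp_measurable measurable_snd)
  have hle : couplingCost c π ≤ ∫⁻ p, ENNReal.ofReal (cX p.1 + cY p.2) ∂π :=
    lintegral_mono fun p => ENNReal.ofReal_le_ofReal (hc_le p.1 p.2)
  exact (hle.trans_lt (hI.lintegral_lt_top)).ne

lemma isCoupling_compProd (μ : Measure X) [SFinite μ] (K : Kernel X Y) [IsMarkovKernel K] :
    IsCoupling (μ.compProd K) μ (μ.bind K) :=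
  ⟨Measure.fst_compProd μ K, Measure.snd_compProd μ K⟩

end FiniteCost

/-! ### Minimality of the Jordan decomposition -/

section Jordan

variable {Y : Type*} [MeasurableSpace Y]

/-- Minimality of the Jordan decomposition. -/
lemma MeasureTheory.JordanDecomposition.posPart_le_of_sub_eq (j : JordanDecomposition Y)
    {p q : Measure Y} [IsFiniteMeasure p] [IsFiniteMeasure q]
    (h : p.toSignedMeasure - q.toSignedMeasure = j.toSignedMeasure) : j.posPart ≤ p := by
  obtain ⟨S, hS, hpos, hneg⟩ := j.mutuallySingular
  refine Measure.le_iff.2 fun E hE => ?_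
  have hES := hE.inter hS.compl
  have h1 := congrArg (fun s : SignedMeasure Y => s (E ∩ Sᶜ)) h
  simp only [JordanDecomposition.toSignedMeasure, sub_apply,
    Measure.toSignedMeasure_apply_measurable hES] at h1
  have h2 : j.negPart.real (E ∩ Sᶜ) = 0 := by
    rw [Measure.real, measure_mono_null Set.inter_subset_right hneg, ENNReal.toReal_zero]
  have h3 : j.posPart.real (E ∩ Sᶜ) ≤ p.real (E ∩ Sᶜ) := by
    have : 0 ≤ q.real (E ∩ Sᶜ) := measureReal_nonneg
    linarith
  calc j.posPart E ≤ j.posPart (E ∩ Sᶜ) + j.posPart (E ∩ S) := by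
        rw [add_comm, ← Set.sdiff_eq, measure_inter_add_sdiff _ hS]
    _ = j.posPart (E ∩ Sᶜ) := by
        rw [measure_mono_null Set.inter_subset_right hpos, add_zero]
    _ ≤ p (E ∩ Sᶜ) := (ENNReal.toReal_le_toReal (measure_ne_top _ _) (measure_ne_top _ _)).1 h3
    _ ≤ p E := measure_mono Set.inter_subset_left

/-- A representation `p - q` of a signed measure whose parts have the total masses of the parts of
the Jordan decomposition is the Jordan decomposition. -/
lemma MeasureTheory.JordanDecomposition.eq_parts_of_sub_eq (j : JordanDecomposition Y)
    {p q : Measure Y} [IsFiniteMeasure p] [IsFiniteMeasure q]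
    (h : p.toSignedMeasure - q.toSignedMeasure = j.toSignedMeasure)
    (hp : p Set.univ = j.posPart Set.univ) : p = j.posPart ∧ q = j.negPart := by
  have hpj : p = j.posPart :=
    (Measure.eq_of_le_of_measure_univ_eq (j.posPart_le_of_sub_eq h) hp.symm).symm
  subst hpj
  refine ⟨rfl, ?_⟩
  rw [JordanDecomposition.toSignedMeasure] at h
  exact Measure.toSignedMeasure_eq_toSignedMeasure_iff.1 (sub_right_injective h)

lemma MeasureTheory.SignedMeasure.posPart_univ_eq {X : Type*} [MeasurableSpace X]
    {a : SignedMeasure X} {b : SignedMeasure Y}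
    (hmass : a.totalVariation Set.univ = b.totalVariation Set.univ)
    (hintegral : a Set.univ = b Set.univ) :
    a.toJordanDecomposition.posPart Set.univ = b.toJordanDecomposition.posPart Set.univ := by
  rw [← a.toSignedMeasure_toJordanDecomposition,
    ← b.toSignedMeasure_toJordanDecomposition] at hintegral
  simp only [JordanDecomposition.toSignedMeasure, sub_apply,
    Measure.toSignedMeasure_apply_measurable MeasurableSet.univ] at hintegral
  simp only [SignedMeasure.totalVariation, Measure.add_apply] at hmass
  have h := congrArg ENNReal.toReal hmass
  rw [ENNReal.toReal_add (measure_ne_top _ _) (measure_ne_top _ _),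
    ENNReal.toReal_add (measure_ne_top _ _) (measure_ne_top _ _)] at h
  simp only [Measure.real] at hintegral
  refine (ENNReal.toReal_eq_toReal_iff' (measure_ne_top _ _) (measure_ne_top _ _)).1 ?_
  linarith

end Jordan

/-! ### Optimal transport kernels -/

section Kernel

variable {X Y : Type*} [MeasurableSpace X] [MeasurableSpace Y]

lemma le_smul_of_mem_boundedACProb {cX : X → ℝ} {α η : Measure X} [IsFiniteMeasure α]
    (h : η ∈ boundedACProb cX α) : ∃ M : ℝ, η ≤ ENNReal.ofReal M • α := by
  obtain ⟨_, -, hac, M, hM⟩ := h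
  refine ⟨M, ?_⟩
  rw [← Measure.withDensity_rnDeriv_eq η α hac, ← withDensity_const]
  exact withDensity_mono hM

lemma normalized_mem_boundedACProb {cX : X → ℝ} {α : Measure X} [IsFiniteMeasure α]
    (hα : α ≠ 0) (hX : Integrable cX α) : (α Set.univ)⁻¹ • α ∈ boundedACProb cX α := by
  have hne : α Set.univ ≠ 0 := by simpa using hα
  have hfin : (α Set.univ)⁻¹ ≠ ∞ := ENNReal.inv_ne_top.2 hne
  refine ⟨⟨?_⟩, hX.smul_measure hfin, Measure.smul_absolutelyContinuous,
    ((α Set.univ)⁻¹).toReal, ?_⟩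
  · rw [Measure.smul_apply, smul_eq_mul, ENNReal.inv_mul_cancel hne (measure_ne_top _ _)]
  · filter_upwards [Measure.rnDeriv_smul_left_of_ne_top α α hfin, Measure.rnDeriv_self α]
      with x h1 h2
    rw [h1, Pi.smul_apply, h2, smul_eq_mul, mul_one, ENNReal.ofReal_toReal hfin]

/-- Couplings of mutually singular measures can be disintegrated by one common kernel. -/
lemma exists_kernel_compProd_eq_of_mutuallySingular [StandardBorelSpace Y] [Nonempty Y]
    {γ₁ γ₂ : Measure (X × Y)} [IsFiniteMeasure γ₁] [IsFiniteMeasure γ₂]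
    (h : γ₁.fst ⟂ₘ γ₂.fst) :
    ∃ (K : Kernel X Y) (_ : IsMarkovKernel K), γ₁.fst.compProd K = γ₁ ∧
      γ₂.fst.compProd K = γ₂ := by
  classical
  obtain ⟨S, hS, h1, h2⟩ := h
  refine ⟨Kernel.piecewise hS γ₂.condKernel γ₁.condKernel, inferInstance, ?_, ?_⟩
  · conv_rhs => rw [← Measure.disintegrate γ₁ γ₁.condKernel]
    refine Measure.compProd_congr ?_
    filter_upwards [measure_eq_zero_iff_ae_notMem.1 h1] with x hx
    rw [Kernel.piecewise_apply, if_neg hx]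
  · conv_rhs => rw [← Measure.disintegrate γ₂ γ₂.condKernel]
    refine Measure.compProd_congr ?_
    filter_upwards [measure_eq_zero_iff_ae_notMem.1 h2] with x hx
    rw [Kernel.piecewise_apply, if_pos (not_not.1 hx)]

/-- For an optimal transport kernel `K` on the measures with bounded density with respect to `α`,
the product of `α` and `K` has `c`-cyclically monotone support. -/
theorem IsOptimalTransportKernelOn.isCCyclicallyMonotone_support [TopologicalSpace X]
    [OpensMeasurableSpace X] [SecondCountableTopology X] [TopologicalSpace Y]
    [OpensMeasurableSpace Y] {c : X × Y → ℝ}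
    (hc : Continuous c) (hc_nonneg : ∀ p, 0 ≤ c p) {cX : X → ℝ} {cY : Y → ℝ}
    (hc_le : ∀ x y, c (x, y) ≤ cX x + cY y) {α : Measure X} [IsFiniteMeasure α]
    {K : Kernel X Y} [IsMarkovKernel K] (hX : Integrable cX α) (hY : Integrable cY (α.bind K))
    (hK : IsOptimalTransportKernelOn c (boundedACProb cX α) K) :
    IsCCyclicallyMonotone c (α.compProd K).support := by
  rcases eq_or_ne α 0 with rfl | hα
  · intro N p hp σ
    rcases N.eq_zero_or_pos with rfl | hN
    · simp
    · simpa using hp ⟨0, hN⟩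
  have hmem := normalized_mem_boundedACProb hα hX
  have hne : (α Set.univ)⁻¹ ≠ 0 := ENNReal.inv_ne_zero.2 (measure_ne_top _ _)
  have hfin : (α Set.univ)⁻¹ ≠ ∞ := ENNReal.inv_ne_top.2 (by simpa using hα)
  set η := (α Set.univ)⁻¹ • α with hη
  have : IsProbabilityMeasure η := hmem.1
  have hcoup := isCoupling_compProd η K
  have hYη : Integrable cY (η.bind K) := by
    rw [hη, Measure.comp_smul]
    exact hY.smul_measure hfin
  have hcost := hcoup.couplingCost_ne_top hc_le hmem.2.1 hYη
  have hopt := hK.2 η hmem ((iInf₂_le (η.compProd K) hcoup).trans_lt hcost.lt_top)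
  have hsupp : (α.compProd K).support ⊆ (η.compProd K).support :=
    ((Measure.absolutelyContinuous_smul hne).compProd_left K).support_mono
  intro N p hp σ
  exact hopt.isCCyclicallyMonotone_support hc hc_nonneg hcost N p (fun i => hsupp (hp i)) σ

variable [TopologicalSpace X] [PolishSpace X] [BorelSpace X] [Nonempty X]
  [TopologicalSpace Y] [PolishSpace Y] [BorelSpace Y]

/-- A kernel whose product with `α` is concentrated on a `c`-cyclically monotone set is an optimal
transport kernel. -/
theorem IsCCyclicallyMonotone.isOptimalTransportKernelOn {c : X × Y → ℝ} (hc : Continuous c)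
    (hc_nonneg : ∀ p, 0 ≤ c p) {cX : X → ℝ} {cY : Y → ℝ}
    (hc_le : ∀ x y, c (x, y) ≤ cX x + cY y) {Γ : Set (X × Y)} (hΓ : IsCCyclicallyMonotone c Γ)
    {α : Measure X} [IsFiniteMeasure α] {K : Kernel X Y} [IsMarkovKernel K]
    (hα : ∀ᵐ p ∂α.compProd K, p ∈ Γ) (hY : Integrable cY (α.bind K)) :
    IsOptimalTransportKernelOn c (boundedACProb cX α) K := by
  refine ⟨inferInstance, fun η hη _ => ?_⟩
  obtain ⟨M, hM⟩ := le_smul_of_mem_boundedACProb hη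
  obtain ⟨_, hX, hac, -⟩ := hη
  have hYη : Integrable cY (η.bind K) := by
    refine (hY.smul_measure (ENNReal.ofReal_ne_top (r := M))).mono_measure ?_
    rw [← Measure.comp_smul]
    refine Measure.le_iff.2 fun s hs => ?_
    rw [Measure.bind_apply hs K.aemeasurable, Measure.bind_apply hs K.aemeasurable]
    exact lintegral_mono' hM le_rfl
  have hcoup := isCoupling_compProd η K
  exact hΓ.isOptimalCoupling hc hc_nonneg hcoup (hac.compProd_left K hα)
    (hcoup.couplingCost_ne_top hc_le hX hYη)

end Kernel

/-! ### The equivalence for signed measures -/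

theorem theorem5p1 {X Y : Type*}
    [TopologicalSpace X] [PolishSpace X] [MeasurableSpace X] [BorelSpace X] [Nonempty X]
    [TopologicalSpace Y] [PolishSpace Y] [MeasurableSpace Y] [BorelSpace Y] [Nonempty Y]
    (c : X × Y → ℝ) (hc : Continuous c) (hc_nonneg : ∀ p, 0 ≤ c p)
    (cX : X → ℝ) (cY : Y → ℝ) (hc_le : ∀ x y, c (x, y) ≤ cX x + cY y)
    (a : SignedMeasure X) (b : SignedMeasure Y)
    (hmass : a.totalVariation Set.univ = b.totalVariation Set.univ)
    (hintegral : a Set.univ = b Set.univ)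
    (ha : Integrable cX a.totalVariation) (hb : Integrable cY b.totalVariation) :
    ConnectedByOptimalTransportKernel c cX a b ↔
      ∃ γp γm : Measure (X × Y),
        IsOptimalCoupling c γp a.toJordanDecomposition.posPart b.toJordanDecomposition.posPart ∧
        IsOptimalCoupling c γm a.toJordanDecomposition.negPart b.toJordanDecomposition.negPart ∧
        CCMCompatible c γp γm := by
  have hα : a.totalVariation =
      a.toJordanDecomposition.posPart + a.toJordanDecomposition.negPart := rfl
  have hβ : b.totalVariation =
      b.toJordanDecomposition.posPart + b.toJordanDecomposition.negPart := rfl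
  set ap := a.toJordanDecomposition.posPart
  set am := a.toJordanDecomposition.negPart
  set bp := b.toJordanDecomposition.posPart
  set bm := b.toJordanDecomposition.negPart
  have hbsum : bp.toSignedMeasure - bm.toSignedMeasure = b :=
    b.toSignedMeasure_toJordanDecomposition
  constructor
  · rintro ⟨K, _, hab, hK⟩
    obtain ⟨hKp, hKm⟩ : ap.bind K = bp ∧ am.bind K = bm := by
      refine JordanDecomposition.eq_parts_of_sub_eq b.toJordanDecomposition ?_ ?_
      · rw [b.toSignedMeasure_toJordanDecomposition]; exact hab
      · rw [Measure.comp_apply_univ]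
        exact SignedMeasure.posPart_univ_eq hmass hintegral
    have hKα : a.totalVariation.bind K = b.totalVariation := by
      rw [hα, hβ, Measure.comp_add, hKp, hKm]
    have hcm := hK.isCCyclicallyMonotone_support hc hc_nonneg hc_le ha (by rwa [hKα])
    rw [hα, Measure.compProd_add_left, Measure.support_add] at hcm
    rw [hα] at ha
    rw [hβ] at hb
    have hcp := isCoupling_compProd ap K
    have hcm' := isCoupling_compProd am K
    rw [hKp] at hcp
    rw [hKm] at hcm'
    refine ⟨ap.compProd K, am.compProd K, ?_, ?_, hcm⟩
    · refine hcm.isOptimalCoupling hc hc_nonneg hcp ?_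
        (hcp.couplingCost_ne_top hc_le ha.left_of_add_measure hb.left_of_add_measure)
      filter_upwards [(ap.compProd K).support_mem_ae] with p hp using Or.inl hp
    · refine hcm.isOptimalCoupling hc hc_nonneg hcm' ?_
        (hcm'.couplingCost_ne_top hc_le ha.right_of_add_measure hb.right_of_add_measure)
      filter_upwards [(am.compProd K).support_mem_ae] with p hp using Or.inr hp
  · rintro ⟨γp, γm, ⟨⟨hp1, hp2⟩, -⟩, ⟨⟨hm1, hm2⟩, -⟩, hΓ⟩
    have := (show IsCoupling γp ap bp from ⟨hp1, hp2⟩).isFiniteMeasure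
    have := (show IsCoupling γm am bm from ⟨hm1, hm2⟩).isFiniteMeasure
    have hsing : γp.fst ⟂ₘ γm.fst := by
      rw [Measure.fst, Measure.fst, hp1, hm1]
      exact a.toJordanDecomposition.mutuallySingular
    obtain ⟨K, _, hKp, hKm⟩ := exists_kernel_compProd_eq_of_mutuallySingular hsing
    rw [Measure.fst, hp1] at hKp
    rw [Measure.fst, hm1] at hKm
    have hKbp : ap.bind K = bp := by rw [← Measure.snd_compProd, hKp, ← hp2]; rfl
    have hKbm : am.bind K = bm := by rw [← Measure.snd_compProd, hKm, ← hm2]; rfl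
    refine ⟨K, inferInstance, ?_, ?_⟩
    · rw [← hbsum]
      unfold signedImage
      congr 1 <;> (congr 1)
    · refine IsCCyclicallyMonotone.isOptimalTransportKernelOn hc hc_nonneg hc_le hΓ ?_ ?_
      · rw [hα, Measure.compProd_add_left, hKp, hKm, ae_add_measure_iff]
        constructor
        · filter_upwards [γp.support_mem_ae] with p hp using Or.inl hp
        · filter_upwards [γm.support_mem_ae] with p hp using Or.inr hp
      · rwa [hα, Measure.comp_add, hKbp, hKbm, ← hβ]
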